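/- Let $p$ be any prime (including $p=2$), and let $B$ be a $p$-adic Banach algebra over $\mathbb{Q}_p$, i.e. a (not necessarily commutative) unital $\mathbb{Q}_p$-algebra, complete with respect to a norm satisfying $\|x\|=0\iff x=0$, $\|x+y\|\le\max(\|x\|,\|y\|)$, $\|\lambda x\|=|\lambda|_p\|x\|$ for $\lambda\in\mathbb{Q}_p$, $\|xy\|\le\|x\|\|y\|$ and $\|1\|=1$. Assume that the norm takes values in $p^{\mathbb{Z}}\cup\{0\}$. Let $A=B^0=\{b\in B:\|b\|\le 1\}$ and let $U^1=1+pA$ be the normal subgroup of $1$-units of $A^*$. Let $\mathrm{tr}_B:B\to\mathbb{Q}_p$ be a trace functional, i.e. a continuous $\mathbb{Q}_p$-linear map vanishing on all commutators $ab-ba$ with $a,b\in B$. Then: 1. For $u\in U^1$ the series $\log u=-\sum_{\nu=1}^{\infty}\frac{(1-u)^{\nu}}{\nu}$ converges in $B$, and $\log u\in A$. 2. The map $U^1\to\mathbb{Q}_p$, $u\mapsto \mathrm{tr}_B(\log u)$, is a homomorphism from the group $U^1$ to the additive group of $\mathbb{Q}_p$. If $\mathrm{tr}_B(A)\subseteq\mathbb{Z}_p$,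 it takes values in $\mathbb{Z}_p$, i.e. it is a homomorphism $U^1\to\mathbb{Z}_p$. 3. For all $u\in U^1$ and $a\in A^*$ one has $\mathrm{tr}_B(\log(aua^{-1}))=\mathrm{tr}_B(\log u)$. -/

import Mathlib

/-- The subring `B⁰` of elements of norm at most one in an ultrametric unital normed ring. -/
def unitBallSubring (B : Type*) [NormedRing B] [NormOneClass B] [IsUltrametricDist B] :
    Subring B where
  carrier := {b | ‖b‖ ≤ 1}
  mul_mem' {a b} ha hb := (norm_mul_le a b).trans (mul_le_one₀ ha (norm_nonneg b) hb)
  one_mem' := norm_one.le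
  add_mem' {a b} ha hb := (IsUltrametricDist.norm_add_le_max a b).trans (max_le ha hb)
  zero_mem' := by simp
  neg_mem' {a} ha := by simpa using ha

/-- The group `U¹ = 1 + pA` of `1`-units, as a subgroup of `Aˣ`, where `A = B⁰`. -/
def oneUnits (p : ℕ) (B : Type*) [NormedRing B] [NormOneClass B] [IsUltrametricDist B] :
    Subgroup (unitBallSubring B)ˣ where
  carrier := {u | ∃ a : unitBallSubring B, (u : unitBallSubring B) = 1 + (p : unitBallSubring B) * a}
  one_mem' := ⟨0, by simp⟩
  mul_mem' := by
    rintro u v ⟨a, ha⟩ ⟨b, hb⟩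
    refine ⟨a + b + a * p * b, ?_⟩
    rw [Units.val_mul, ha, hb]
    noncomm_ring
  inv_mem' := by
    rintro u ⟨a, ha⟩
    refine ⟨-(a * (u⁻¹ : (unitBallSubring B)ˣ)), ?_⟩
    have h := u.mul_inv
    rw [ha, add_mul, one_mul, mul_assoc] at h
    rw [mul_neg, ← sub_eq_add_neg]
    exact eq_sub_of_add_eq h

/-- The `1`-units form a normal subgroup of `Aˣ`. -/
instance oneUnits_normal (p : ℕ) (B : Type*) [NormedRing B] [NormOneClass B]
    [IsUltrametricDist B] : (oneUnits p B).Normal where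
  conj_mem := by
    rintro u ⟨a, ha⟩ g
    refine ⟨g.val * a * (g⁻¹ : (unitBallSubring B)ˣ), ?_⟩
    rw [Units.val_mul, Units.val_mul, ha, mul_add, add_mul, mul_one, Units.mul_inv,
      ← mul_assoc g.val, ← Nat.cast_comm, mul_assoc, mul_assoc, mul_assoc]

/-- When `B` is a complete `p`-adic algebra, every element of `1 + pA` is a unit of `A`, so that
`oneUnits p B` really is the whole set `1 + pA`. -/
theorem exists_oneUnits_eq (p : ℕ) [Fact p.Prime] (B : Type*) [NormedRing B]
    [NormedAlgebra ℚ_[p] B] [NormOneClass B] [IsUltrametricDist B] [CompleteSpace B]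
    (a : unitBallSubring B) :
    ∃ u ∈ oneUnits p B, (u : unitBallSubring B) = 1 + (p : unitBallSubring B) * a := by
  have hp : ‖(p : B)‖ < 1 := by
    have h : (p : B) = algebraMap ℚ_[p] B p := by simp
    rw [h, norm_algebraMap', Padic.norm_p]
    exact inv_lt_one_of_one_lt₀ (by exact_mod_cast (Fact.out : p.Prime).one_lt)
  have hc : IsClosed ((unitBallSubring B : Subring B) : Set B) :=
    isClosed_le continuous_norm continuous_const
  have : CompleteSpace (unitBallSubring B) := hc.completeSpace_coe
  have hx : ‖-((p : unitBallSubring B) * a)‖ < 1 := by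
    rw [norm_neg]
    have h1 : ‖(p : unitBallSubring B) * a‖ ≤ ‖(p : B)‖ * ‖(a : B)‖ := norm_mul_le (p : B) (a : B)
    exact h1.trans_lt ((mul_le_of_le_one_right (norm_nonneg _) a.2).trans_lt hp)
  refine ⟨Units.oneSub _ hx, ⟨a, ?_⟩, ?_⟩ <;> simp [Units.oneSub]

/-- The terms `(1 - u)^ν / ν`, `ν = n + 1 ≥ 1`, of the logarithmic series. -/
noncomputable def logTerm (p : ℕ) [Fact p.Prime] {B : Type*} [NormedRing B]
    [NormedAlgebra ℚ_[p] B] (u : B) (n : ℕ) : B :=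
  ((n + 1 : ℕ) : ℚ_[p])⁻¹ • (1 - u) ^ (n + 1)

/-- The logarithm `log u = - ∑_{ν ≥ 1} (1 - u)^ν / ν`. -/
noncomputable def padicLog (p : ℕ) [Fact p.Prime] {B : Type*} [NormedRing B]
    [NormedAlgebra ℚ_[p] B] (u : B) : B :=
  -∑' n : ℕ, logTerm p u n

/-- A trace functional on `B`: a continuous linear form which vanishes on all commutators. -/
structure TraceFunctional (p : ℕ) [Fact p.Prime] (B : Type*) [NormedRing B]
    [NormedAlgebra ℚ_[p] B] where
  toCLM : B →L[ℚ_[p]] ℚ_[p]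
  map_commutator : ∀ a b : B, toCLM (a * b - b * a) = 0

section

open Polynomial

/-! Only additivity is deep, since `log (u * v) = log u + log v` fails without commutativity. For `u
= 1 - x`, `v = 1 - y`, take `w` in `B[X]` with `1 - w = (1 - xX)(1 - yX)`, so that `w(1) = 1 - uv`.
Under a trace the logarithmic derivative is additive, so the traced logarithms agree coefficient by
coefficient (`sum_map_coeff_pow_eq`).

To specialise to `X = 1`, consider the double family of traced coefficients of `w ^ (n + 1) / (n +
1)`. It is summable, its row sums give the series for `uv`, and its column sums give those for `u`
and `v`; `TraceFunctional.map_padicLog_mul` exchanges the two summations. -/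

/-! ### Formal logarithmic derivatives under a trace -/

/-- The product rule gives terms `w ^ i * w' * w ^ j`, which cyclicity identifies. The factor `w ^
m` absorbs the right-hand powers in the induction. -/
theorem map_derivative_pow_mul_pow {B M : Type*} [Ring B] [AddCommMonoid M] (L : B[X] →+ M)
    (hL : ∀ f g, L (f * g) = L (g * f)) (w : B[X]) (n m : ℕ) :
    L (derivative (w ^ (n + 1)) * w ^ m) = (n + 1) • L (w ^ (n + m) * derivative w) := by
  induction n generalizing m with
  | zero => simp [hL]
  | succ n ih =>
    have h : L (w ^ (n + 1) * derivative w * w ^ m) = L (w ^ (n + 1 + m) * derivative w) := by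
      rw [hL, ← mul_assoc, ← pow_add, add_comm m]
    rw [pow_succ w (n + 1), derivative_mul, add_mul, map_add, mul_assoc, ← pow_succ', ih, h,
      succ_nsmul _ (n + 1), show n + (m + 1) = n + 1 + m by ring]

theorem natCast_mul_sum_map_coeff_pow {K B : Type*} [Field K] [CharZero K] [Ring B] [Algebra K B]
    (τ : B →ₗ[K] K) (hτ : ∀ a b, τ (a * b) = τ (b * a)) (w : B[X]) (N k : ℕ) :
    ((k + 1 : ℕ) : K) *
        ∑ n ∈ Finset.range N, ((n + 1 : ℕ) : K)⁻¹ * τ ((w ^ (n + 1)).coeff (k + 1)) =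
      τ (((∑ n ∈ Finset.range N, w ^ n) * derivative w).coeff k) := by
  have hL : ∀ f g : B[X], τ ((f * g).coeff k) = τ ((g * f).coeff k) := by
    intro f g
    rw [coeff_mul, coeff_mul, ← Finset.Nat.sum_antidiagonal_swap, map_sum, map_sum]
    exact Finset.sum_congr rfl fun i _ => hτ _ _
  let L : B[X] →+ K := τ.toAddMonoidHom.comp (lcoeff B k).toAddMonoidHom
  have key : ∀ n, ((n + 1 : ℕ) : K)⁻¹ * τ ((derivative (w ^ (n + 1))).coeff k) =
      τ ((w ^ n * derivative w).coeff k) := by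
    intro n
    have h := map_derivative_pow_mul_pow L hL w n 0
    simp only [pow_zero, mul_one, add_zero, nsmul_eq_mul] at h
    change τ ((derivative (w ^ (n + 1))).coeff k) = _ * τ ((w ^ n * derivative w).coeff k) at h
    rw [h, inv_mul_cancel_left₀ (Nat.cast_ne_zero.mpr n.succ_ne_zero)]
  rw [Finset.sum_mul, finsetSum_coeff, map_sum, Finset.mul_sum]
  refine Finset.sum_congr rfl fun n _ => ?_
  rw [← key, coeff_derivative, mul_left_comm]
  congr 1
  rw [← Nat.cast_succ, ← Nat.cast_comm, ← nsmul_eq_mul, ← nsmul_eq_mul, map_nsmul]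

theorem X_pow_dvd_mul_left {B : Type*} [Semiring B] {f : B[X]} {N : ℕ} (h : X ^ N ∣ f)
    (g : B[X]) : X ^ N ∣ g * f := by
  obtain ⟨c, rfl⟩ := h
  exact ⟨g * c, by rw [← mul_assoc, ← mul_assoc, (commute_X_pow g N).eq]⟩

theorem X_pow_dvd_pow {B : Type*} [Semiring B] {f : B[X]} (h : X ∣ f) (N : ℕ) :
    X ^ N ∣ f ^ N := by
  obtain ⟨c, rfl⟩ := h
  exact ⟨c ^ N, (commute_X c).mul_pow N⟩

/-- Truncated geometric sums serve as inverses of `1 - f`, `1 - g`, `1 - w` modulo `X ^ N`; `X` is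
central, so such congruences may be multiplied on either side. -/
theorem map_coeff_logDeriv_mul {K B : Type*} [Field K] [Ring B] [Algebra K B]
    (τ : B →ₗ[K] K) (hτ : ∀ a b, τ (a * b) = τ (b * a)) {f g w : B[X]}
    (hf : X ∣ f) (hg : X ∣ g) (hw : 1 - w = (1 - f) * (1 - g)) {N k : ℕ} (hk : k < N) :
    τ (((∑ n ∈ Finset.range N, w ^ n) * derivative w).coeff k) =
      τ (((∑ n ∈ Finset.range N, f ^ n) * derivative f).coeff k) +
        τ (((∑ n ∈ Finset.range N, g ^ n) * derivative g).coeff k) := by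
  have hL : ∀ f g : B[X], τ ((f * g).coeff k) = τ ((g * f).coeff k) := by
    intro f g
    rw [coeff_mul, coeff_mul, ← Finset.Nat.sum_antidiagonal_swap, map_sum, map_sum]
    exact Finset.sum_congr rfl fun i _ => hτ _ _
  have hXw : X ∣ w := by
    have h : w = f + (1 - f) * g := by
      rw [← sub_sub_self 1 w, hw]; noncomm_ring
    rw [h]
    exact dvd_add hf (by simpa using X_pow_dvd_mul_left (N := 1) (by simpa using hg) (1 - f))
  have hw' : derivative w = derivative f * (1 - g) + (1 - f) * derivative g := by
    have h := congrArg derivative hw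
    simp only [derivative_mul, derivative_sub, derivative_one, zero_sub] at h
    rw [← neg_inj, h]; noncomm_ring
  have hfN := X_pow_dvd_pow hf N
  have hgN := X_pow_dvd_pow hg N
  have hwN := X_pow_dvd_pow hXw N
  have ef := mul_neg_geom_sum f N
  have eg := mul_neg_geom_sum g N
  have ew := geom_sum_mul_neg w N
  set F := ∑ n ∈ Finset.range N, f ^ n
  set G := ∑ n ∈ Finset.range N, g ^ n
  set W := ∑ n ∈ Finset.range N, w ^ n
  -- Right multiplication by `1 - g` makes this a multiple of `w ^ N`; then `1 - g` is cancelled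
  -- using `G`.
  have h1 : X ^ N ∣ (1 - g) * W * (1 - f) - 1 := by
    have h : (1 - g) * W * (1 - f) - 1 =
        ((1 - g) * W * (1 - f) - 1) * g ^ N + -((1 - g) * w ^ N) * G := by
      have h2 : ((1 - g) * W * (1 - f) - 1) * (1 - g) = -((1 - g) * w ^ N) := by
        rw [sub_mul, mul_assoc _ (1 - f), ← hw, mul_assoc, ew]; noncomm_ring
      rw [← h2, mul_assoc _ (1 - g) G, eg]; noncomm_ring
    rw [h]
    exact dvd_add (X_pow_dvd_mul_left hgN _)
      (((dvd_neg).mpr (X_pow_dvd_mul_left hwN _)).mul_right _)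
  have h2 : X ^ N ∣ (1 - g) * W - F := by
    have h : (1 - g) * W - F = (1 - g) * W * f ^ N + ((1 - g) * W * (1 - f) - 1) * F := by
      rw [sub_mul _ 1 F, mul_assoc _ (1 - f) F, ef]; noncomm_ring
    rw [h]
    exact dvd_add (X_pow_dvd_mul_left hfN _) (h1.mul_right _)
  have h3 : X ^ N ∣ W * (1 - f) - G := by
    have h : W * (1 - f) - G = W * (1 - f) * g ^ N - w ^ N * G := by
      have h4 : W * (1 - f) * (1 - g ^ N) = (1 - w ^ N) * G := by
        rw [← eg, ← ew, hw]; noncomm_ring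
      rw [mul_sub, sub_mul, mul_one, one_mul] at h4
      rw [eq_sub_iff_add_eq, sub_add, eq_comm, eq_sub_iff_add_eq, ← eq_sub_iff_add_eq', ← h4]
    rw [h]
    exact dvd_sub (X_pow_dvd_mul_left hgN _) (hwN.mul_right _)
  have h4 := X_pow_dvd_iff.mp (h2.mul_right (derivative f)) k hk
  have h5 := X_pow_dvd_iff.mp (h3.mul_right (derivative g)) k hk
  rw [sub_mul, coeff_sub, sub_eq_zero] at h4 h5
  -- Cyclicity turns `W * f' * (1 - g)` into `(1 - g) * W * f'`, where `h2` applies.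
  rw [← h4, ← h5, hw', mul_add, coeff_add, map_add, ← mul_assoc, hL, mul_assoc, mul_assoc]

theorem sum_map_coeff_pow_eq {K B : Type*} [Field K] [CharZero K] [Ring B] [Algebra K B]
    (τ : B →ₗ[K] K) (hτ : ∀ a b, τ (a * b) = τ (b * a)) (x y : B) {w : B[X]}
    (hw : 1 - w = (1 - C x * X) * (1 - C y * X)) {N k : ℕ} (hk : k < N) :
    ∑ n ∈ Finset.range N, ((n + 1 : ℕ) : K)⁻¹ * τ ((w ^ (n + 1)).coeff (k + 1)) =
      ((k + 1 : ℕ) : K)⁻¹ * τ (x ^ (k + 1)) + ((k + 1 : ℕ) : K)⁻¹ * τ (y ^ (k + 1)) := by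
  have hdvd : ∀ z : B, X ∣ C z * X := fun z => ⟨C z, (commute_X _).eq.symm⟩
  have hmono : ∀ z : B,
      ∑ n ∈ Finset.range N, ((n + 1 : ℕ) : K)⁻¹ * τ (((C z * X) ^ (n + 1)).coeff (k + 1)) =
        ((k + 1 : ℕ) : K)⁻¹ * τ (z ^ (k + 1)) := by
    intro z
    rw [Finset.sum_eq_single_of_mem k (Finset.mem_range.mpr hk)]
    · rw [(commute_X (C z)).symm.mul_pow, ← C_pow, coeff_C_mul_X_pow, if_pos rfl]
    · intro n _ hn
      rw [(commute_X (C z)).symm.mul_pow, ← C_pow, coeff_C_mul_X_pow,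
        if_neg (by simpa using hn.symm), map_zero, mul_zero]
  refine mul_left_cancel₀ (Nat.cast_ne_zero.mpr k.succ_ne_zero : ((k + 1 : ℕ) : K) ≠ 0) ?_
  rw [natCast_mul_sum_map_coeff_pow τ hτ, map_coeff_logDeriv_mul τ hτ (hdvd x) (hdvd y) hw hk,
    ← natCast_mul_sum_map_coeff_pow τ hτ, ← natCast_mul_sum_map_coeff_pow τ hτ, hmono, hmono,
    mul_add]

/-! ### Norm estimates and summability -/

theorem norm_inv_natCast_le (p : ℕ) [Fact p.Prime] {n : ℕ} (hn : n ≠ 0) :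
    ‖(n : ℚ_[p])⁻¹‖ ≤ n := by
  rw [norm_inv, Padic.norm_eq_zpow_neg_valuation (Nat.cast_ne_zero.mpr hn), zpow_neg, inv_inv,
    Padic.valuation_natCast, zpow_natCast]
  exact_mod_cast Nat.le_of_dvd (Nat.pos_of_ne_zero hn) pow_padicValNat_dvd

theorem norm_coeff_pow_le {B : Type*} [NormedRing B] [NormOneClass B] [IsUltrametricDist B]
    {w : B[X]} {r : ℝ} (hr : 0 ≤ r) (hw : ∀ k, ‖w.coeff k‖ ≤ r) (n k : ℕ) :
    ‖(w ^ n).coeff k‖ ≤ r ^ n := by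
  induction n generalizing k with
  | zero =>
    rw [pow_zero, pow_zero, coeff_one]
    split_ifs <;> simp
  | succ n ih =>
    rw [pow_succ, pow_succ, coeff_mul]
    refine IsUltrametricDist.norm_sum_le_of_forall_le_of_nonneg (by positivity) fun i _ => ?_
    exact (norm_mul_le _ _).trans (mul_le_mul (ih _) (hw _) (norm_nonneg _) (by positivity))

theorem sum_range_coeff_eq_map_one {B : Type*} [Semiring B] {f : B[X]} {N : ℕ}
    (hN : f.natDegree < N) :
    ∑ k ∈ Finset.range N, f.coeff k =
      eval₂RingHom' (RingHom.id B) 1 (fun a => Commute.one_right a) f := by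
  change _ = eval₂ (RingHom.id B) 1 f
  simp [eval₂_eq_sum_range' _ hN]

theorem summable_pow_mul_geometric_succ {r : ℝ} (hr : 0 ≤ r) (hr1 : r < 1) (m : ℕ) :
    Summable fun n : ℕ => ((n + 1 : ℕ) : ℝ) ^ m * r ^ (n + 1) := by
  have h : Summable fun n : ℕ => (n : ℝ) ^ m * r ^ n :=
    summable_pow_mul_geometric_of_norm_lt_one m (by rwa [Real.norm_of_nonneg hr])
  exact h.comp_injective (add_left_injective 1)

/-- Majorant for the double family: `w` has degree at most 2, so row `n` has at most `2 * (n + 1)`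
nonzero entries. -/
theorem summable_indicator_mul_geometric {r : ℝ} (hr : 0 ≤ r) (hr1 : r < 1) (c : ℝ)
    (hc : 0 ≤ c) :
    Summable fun i : ℕ × ℕ =>
      if i.2 < 2 * (i.1 + 1) then c * (((i.1 + 1 : ℕ) : ℝ) * r ^ (i.1 + 1)) else 0 := by
  have hts : ∀ n : ℕ, ∀ k ∉ Finset.range (2 * (n + 1)),
      (if k < 2 * (n + 1) then c * (((n + 1 : ℕ) : ℝ) * r ^ (n + 1)) else 0) = 0 :=
    fun n k hk => if_neg (by simpa using hk)
  refine (summable_prod_of_nonneg fun i => ?_).mpr ⟨fun n => ?_, ?_⟩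
  · dsimp only
    split_ifs
    · positivity
    · exact le_rfl
  · exact summable_of_ne_finset_zero (hts n)
  · refine ((summable_pow_mul_geometric_succ hr hr1 2).mul_left (2 * c)).congr fun n => ?_
    rw [tsum_eq_sum (hts n), Finset.sum_congr rfl fun k hk => if_pos (Finset.mem_range.mp hk),
      Finset.sum_const, Finset.card_range, nsmul_eq_mul]
    push_cast
    ring

variable {p : ℕ} [Fact p.Prime] {B : Type*} [NormedRing B] [NormedAlgebra ℚ_[p] B]

/-! ### The logarithm and its trace -/

theorem norm_logTerm_le [NormOneClass B] {u : B} (hu : ‖1 - u‖ ≤ (p : ℝ)⁻¹) (n : ℕ) :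
    ‖logTerm p u n‖ ≤ ((n + 1 : ℕ) : ℝ) * (p : ℝ)⁻¹ ^ (n + 1) := by
  rw [logTerm, norm_smul]
  exact mul_le_mul (norm_inv_natCast_le p n.succ_ne_zero)
    ((norm_pow_le _ _).trans (pow_le_pow_left₀ (norm_nonneg _) hu _)) (norm_nonneg _)
    (Nat.cast_nonneg _)

theorem inv_prime_lt_one (p : ℕ) [hp : Fact p.Prime] : (p : ℝ)⁻¹ < 1 :=
  inv_lt_one_of_one_lt₀ (by exact_mod_cast hp.out.one_lt)

theorem summable_logTerm [NormOneClass B] [CompleteSpace B] {u : B}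
    (hu : ‖1 - u‖ ≤ (p : ℝ)⁻¹) : Summable (logTerm p u) := by
  have h := summable_pow_mul_geometric_succ (by positivity) (inv_prime_lt_one p) 1
  simp only [pow_one] at h
  exact Summable.of_norm_bounded h (norm_logTerm_le hu)

theorem norm_padicLog_le_one [NormOneClass B] [IsUltrametricDist B] {u : B}
    (hu : ‖1 - u‖ ≤ (p : ℝ)⁻¹) : ‖padicLog p u‖ ≤ 1 := by
  have hp : p.Prime := Fact.out
  rw [padicLog, norm_neg]
  refine (IsUltrametricDist.norm_tsum_le _).trans (ciSup_le fun n => ?_)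
  refine (norm_logTerm_le hu n).trans ?_
  rw [inv_pow, ← div_eq_mul_inv, div_le_one (pow_pos (by exact_mod_cast hp.pos) _)]
  exact_mod_cast (Nat.lt_pow_self hp.one_lt).le

theorem TraceFunctional.map_mul_comm (tr : TraceFunctional p B) (a b : B) :
    tr.toCLM (a * b) = tr.toCLM (b * a) :=
  sub_eq_zero.mp (by rw [← map_sub, tr.map_commutator])

theorem TraceFunctional.map_padicLog [NormOneClass B] [CompleteSpace B]
    (tr : TraceFunctional p B) {u : B} (hu : ‖1 - u‖ ≤ (p : ℝ)⁻¹) :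
    HasSum (fun n : ℕ => ((n + 1 : ℕ) : ℚ_[p])⁻¹ * tr.toCLM ((1 - u) ^ (n + 1)))
      (-tr.toCLM (padicLog p u)) := by
  rw [padicLog, map_neg, neg_neg]
  simpa [logTerm] using (summable_logTerm hu).hasSum.mapL tr.toCLM

theorem TraceFunctional.map_padicLog_mul [NormOneClass B] [IsUltrametricDist B] [CompleteSpace B]
    (tr : TraceFunctional p B) {u v : B} (hu : ‖1 - u‖ ≤ (p : ℝ)⁻¹) (hv : ‖1 - v‖ ≤ (p : ℝ)⁻¹)
    (huv : ‖1 - u * v‖ ≤ (p : ℝ)⁻¹) :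
    tr.toCLM (padicLog p (u * v)) = tr.toCLM (padicLog p u) + tr.toCLM (padicLog p v) := by
  obtain ⟨x, rfl⟩ : ∃ x, u = 1 - x := ⟨1 - u, by abel⟩
  obtain ⟨y, rfl⟩ : ∃ y, v = 1 - y := ⟨1 - v, by abel⟩
  have hx := tr.map_padicLog hu
  have hy := tr.map_padicLog hv
  have hxy := tr.map_padicLog huv
  simp only [sub_sub_cancel] at hu hv hx hy
  have hp0 : (0 : ℝ) ≤ (p : ℝ)⁻¹ := by positivity
  let w : B[X] := C (x + y) * X ^ 1 - C (x * y) * X ^ 2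
  have hw : 1 - w = (1 - C x * X) * (1 - C y * X) := by
    have h : C x * X * (C y * X) = C (x * y) * X ^ 2 := by
      rw [mul_assoc, ← mul_assoc X, (commute_X (C y)).eq, C_mul, pow_two]
      simp only [mul_assoc]
    rw [sub_mul, mul_sub, mul_sub, h]
    simp only [w, C_add, add_mul, one_mul, mul_one, pow_one]
    abel
  have hcoeff : ∀ k, ‖w.coeff k‖ ≤ (p : ℝ)⁻¹ := by
    intro k
    have hxy' : ‖x * y‖ ≤ (p : ℝ)⁻¹ := (norm_mul_le _ _).trans
      ((mul_le_mul hu hv (norm_nonneg _) hp0).trans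
        (mul_le_of_le_one_right hp0 (inv_prime_lt_one p).le))
    have hadd : ‖x + y‖ ≤ (p : ℝ)⁻¹ :=
      (IsUltrametricDist.norm_add_le_max x y).trans (max_le hu hv)
    simp only [w, coeff_sub, coeff_C_mul_X_pow]
    split_ifs
    · omega
    · rwa [sub_zero]
    · simpa using hxy'
    · simp
  have hXw : X ∣ w := X_dvd_iff.mpr (by simp [w])
  have hdeg : ∀ n, (w ^ n).natDegree ≤ 2 * n := by
    intro n
    rw [mul_comm]
    exact natDegree_pow_le_of_le n (natDegree_sub_le_of_le
      ((natDegree_C_mul_X_pow_le _ _).trans one_le_two) (natDegree_C_mul_X_pow_le _ _))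
  have hvanish : ∀ n k, ¬ k < 2 * (n + 1) → (w ^ (n + 1)).coeff (k + 1) = 0 := fun n k hk =>
    coeff_eq_zero_of_natDegree_lt ((hdeg _).trans_lt (by omega))
  let c : ℕ → ℕ → ℚ_[p] := fun n k =>
    ((n + 1 : ℕ) : ℚ_[p])⁻¹ * tr.toCLM ((w ^ (n + 1)).coeff (k + 1))
  have hc : Summable (Function.uncurry c) := by
    refine Summable.of_norm_bounded
      (summable_indicator_mul_geometric hp0 (inv_prime_lt_one p) ‖tr.toCLM‖ (norm_nonneg _)) ?_
    rintro ⟨n, k⟩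
    simp only [Function.uncurry_apply_pair, c]
    split_ifs with hk
    · rw [norm_mul, mul_left_comm]
      refine mul_le_mul (norm_inv_natCast_le p n.succ_ne_zero) ?_ (norm_nonneg _)
        (Nat.cast_nonneg _)
      exact (tr.toCLM.le_opNorm _).trans
        (mul_le_mul_of_nonneg_left (norm_coeff_pow_le hp0 hcoeff _ _) (norm_nonneg _))
    · simp [hvanish n k hk]
  have hrow : ∀ n, ∑' k, c n k =
      ((n + 1 : ℕ) : ℚ_[p])⁻¹ * tr.toCLM ((1 - (1 - x) * (1 - y)) ^ (n + 1)) := by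
    intro n
    rw [tsum_eq_sum (s := Finset.range (2 * (n + 1)))
      fun k hk => by simp [c, hvanish n k (by simpa using hk)]]
    simp only [c]
    rw [← Finset.mul_sum, ← map_sum]
    -- The index `k + 1` omits only the constant coefficient, so the row sums to the value of `w ^
    -- (n + 1)` at 1.
    have h0 : (w ^ (n + 1)).coeff 0 = 0 := by
      exact X_pow_dvd_iff.mp (X_pow_dvd_pow hXw (n + 1)) 0 n.succ_pos
    have h := sum_range_coeff_eq_map_one (Nat.lt_succ_of_le (hdeg (n + 1)))
    rw [Finset.sum_range_succ', h0, add_zero, map_pow] at h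
    rw [h]
    congr 3
    rw [← sub_sub_self 1 w, hw]
    simp only [map_sub, map_mul, map_one]
    simp
  have hcol : ∀ k, ∑' n, c n k = ((k + 1 : ℕ) : ℚ_[p])⁻¹ * tr.toCLM (x ^ (k + 1)) +
      ((k + 1 : ℕ) : ℚ_[p])⁻¹ * tr.toCLM (y ^ (k + 1)) := by
    intro k
    -- As `X ∣ w`, only `n ≤ k` contributes to column `k`, which makes it a finite formal sum.
    have h0 : ∀ n ∉ Finset.range (k + 1), c n k = 0 := by
      intro n hn
      have := X_pow_dvd_iff.mp (X_pow_dvd_pow hXw (n + 1)) (k + 1) (by simp at hn; omega)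
      simp [c, this]
    rw [tsum_eq_sum h0]
    exact sum_map_coeff_pow_eq (tr.toCLM : B →ₗ[ℚ_[p]] ℚ_[p]) tr.map_mul_comm x y hw k.lt_succ_self
  have hswap := hc.tsum_comm
  simp only [hrow, hcol] at hswap
  rw [hxy.tsum_eq, (hx.add hy).tsum_eq] at hswap
  rw [← neg_inj, ← hswap, neg_add]

end

theorem norm_one_sub_le_of_mem_oneUnits {p : ℕ} [Fact p.Prime] {B : Type*} [NormedRing B]
    [NormedAlgebra ℚ_[p] B] [NormOneClass B] [IsUltrametricDist B] {u : (unitBallSubring B)ˣ}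
    (hu : u ∈ oneUnits p B) : ‖1 - ((u : unitBallSubring B) : B)‖ ≤ (p : ℝ)⁻¹ := by
  obtain ⟨a, ha⟩ := hu
  have hp : ‖(p : B)‖ = (p : ℝ)⁻¹ := by
    rw [← map_natCast (algebraMap ℚ_[p] B), norm_algebraMap', Padic.norm_p]
  have h : 1 - ((u : unitBallSubring B) : B) = -((p : B) * a) := by
    rw [ha]; push_cast; abel
  rw [h, norm_neg, ← hp]
  exact (norm_mul_le _ _).trans (mul_le_of_le_one_right (norm_nonneg _) a.2)

/-- Conjugation commutes with powers, so cyclicity equates the two series term by term. -/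
theorem TraceFunctional.map_padicLog_conj {p : ℕ} [Fact p.Prime] {B : Type*} [NormedRing B]
    [NormedAlgebra ℚ_[p] B] [NormOneClass B] [CompleteSpace B] (tr : TraceFunctional p B)
    {u a b : B} (hab : a * b = 1) (hba : b * a = 1) (hu : ‖1 - u‖ ≤ (p : ℝ)⁻¹)
    (hu' : ‖1 - a * u * b‖ ≤ (p : ℝ)⁻¹) :
    tr.toCLM (padicLog p (a * u * b)) = tr.toCLM (padicLog p u) := by
  rw [← neg_inj]
  refine (tr.map_padicLog hu').unique ?_
  convert tr.map_padicLog hu using 3 with n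
  have h : 1 - a * u * b = a * (1 - u) * b := by rw [mul_sub, sub_mul, mul_one, hab]
  let g : Bˣ := ⟨a, b, hab, hba⟩
  have hpow : (a * (1 - u) * b) ^ (n + 1) = a * (1 - u) ^ (n + 1) * b :=
    g.conj_pow (1 - u) (n + 1)
  rw [h, hpow, tr.map_mul_comm, ← mul_assoc, hba, one_mul]

theorem theorem4p3 (p : ℕ) [Fact p.Prime] {B : Type*} [NormedRing B] [NormedAlgebra ℚ_[p] B]
    [NormOneClass B] [IsUltrametricDist B] [CompleteSpace B]
    (hnorm : ∀ b : B, b ≠ 0 → ∃ n : ℤ, ‖b‖ = (p : ℝ) ^ n)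
    (tr : TraceFunctional p B) :
    -- the logarithmic series converges on `U¹`, with values in `A`
    (∀ u ∈ oneUnits p B, Summable (logTerm p ((u : unitBallSubring B) : B)) ∧
      padicLog p ((u : unitBallSubring B) : B) ∈ unitBallSubring B) ∧
    -- `tr ∘ log` is a homomorphism on `U¹`
    (∃ φ : oneUnits p B →* Multiplicative ℚ_[p], ∀ u : oneUnits p B,
      (φ u).toAdd = tr.toCLM (padicLog p (((u : (unitBallSubring B)ˣ) : unitBallSubring B) : B))) ∧
    -- it takes values in `ℤ_p` as soon as `tr` maps `A` to `ℤ_p`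
    ((∀ a ∈ unitBallSubring B, ‖tr.toCLM a‖ ≤ 1) →
      ∃ ψ : oneUnits p B →* Multiplicative ℤ_[p], ∀ u : oneUnits p B,
        (((ψ u).toAdd : ℤ_[p]) : ℚ_[p]) =
          tr.toCLM (padicLog p (((u : (unitBallSubring B)ˣ) : unitBallSubring B) : B))) ∧
    -- it is invariant under conjugation by units of `A`
    (∀ u ∈ oneUnits p B, ∀ a : (unitBallSubring B)ˣ,
      tr.toCLM (padicLog p (((a * u * a⁻¹ : (unitBallSubring B)ˣ) : unitBallSubring B) : B)) =
        tr.toCLM (padicLog p ((u : unitBallSubring B) : B))) := by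
  have hmul : ∀ u v : oneUnits p B,
      tr.toCLM (padicLog p ((((u * v : oneUnits p B) : (unitBallSubring B)ˣ) :
        unitBallSubring B) : B)) =
      tr.toCLM (padicLog p (((u : (unitBallSubring B)ˣ) : unitBallSubring B) : B)) +
        tr.toCLM (padicLog p (((v : (unitBallSubring B)ˣ) : unitBallSubring B) : B)) :=
    fun u v => tr.map_padicLog_mul (norm_one_sub_le_of_mem_oneUnits u.2)
      (norm_one_sub_le_of_mem_oneUnits v.2) (norm_one_sub_le_of_mem_oneUnits (u * v).2)
  refine ⟨fun u hu => ⟨summable_logTerm (norm_one_sub_le_of_mem_oneUnits hu),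
    norm_padicLog_le_one (norm_one_sub_le_of_mem_oneUnits hu)⟩,
    ⟨MonoidHom.mk' (fun u => Multiplicative.ofAdd (tr.toCLM (padicLog p
      (((u : (unitBallSubring B)ˣ) : unitBallSubring B) : B)))) hmul, fun u => rfl⟩,
    fun htr => ⟨MonoidHom.mk' (fun u => Multiplicative.ofAdd (⟨tr.toCLM (padicLog p
      (((u : (unitBallSubring B)ˣ) : unitBallSubring B) : B)),
      htr _ (norm_padicLog_le_one (norm_one_sub_le_of_mem_oneUnits u.2))⟩ : ℤ_[p]))
      fun u v => Subtype.ext (hmul u v), fun u => rfl⟩, fun u hu a => ?_⟩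
  exact tr.map_padicLog_conj (congrArg Subtype.val a.mul_inv) (congrArg Subtype.val a.inv_mul)
    (norm_one_sub_le_of_mem_oneUnits hu)
    (norm_one_sub_le_of_mem_oneUnits ((oneUnits_normal p B).conj_mem u hu a))
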